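/- A square is a word $XX$ with $X$ a non-empty finite word. A word is square-free if no finite factor of it is a square. A square reduction replaces a finite word $UXXV$ ($X$ non-empty) by $UXV$, and a reduct of a finite word $W$ is any square-free word obtained from $W$ by a finite, possibly empty, sequence of square reductions; $\mathcal R(W)$ denotes the set of reducts of $W$. Theorem 2.6. For every integer $k\ge 1$ there is a word over the 4-letter alphabet $\{a,b,x,y\}$ with exactly $k$ distinct reducts. More precisely, put $F=xabaxababx$, $P=xabx$ and $Q=xabaxabx$. Let $W_\infty$ be any infinite square-free word over $\{a,b,y\}$ starting with the letter $y$, let $W_1,W_2,\dots$ be prefixes of $W_\infty$ of strictly increasing lengths, each ending with the letter $y$, and put $S_i=FW_1FW_2\cdots FW_i$. Such $W_\infty$ and $W_1,W_2,\dots$ exist, and for every choice of them and every $i\ge 1$, $$\mathcal R(S_i)=\{PW_i,\,QW_i\}\cup\{PW_jQW_i : 1\le j<i\},$$ and this set has exactly $i+1$ elements. -/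

import Mathlib

namespace SquareReduct

/-- The four-letter alphabet. -/
inductive Letter where
  | a | b | x | y
  deriving DecidableEq

/-- `W` contains a square: `W = U X X V` with `X` non-empty. -/
def ContainsSquare {α : Type*} (W : List α) : Prop :=
  ∃ U X V : List α, X ≠ [] ∧ W = U ++ X ++ X ++ V

/-- A finite word is square-free if it contains no square. -/
def IsSquareFree {α : Type*} (W : List α) : Prop :=
  ¬ ContainsSquare W

/-- A single square reduction `U X X V → U X V`, with `X` non-empty. -/
def SquareReduction {α : Type*} (W W' : List α) : Prop :=
  ∃ U X V : List α, X ≠ [] ∧ W = U ++ X ++ X ++ V ∧ W' = U ++ X ++ V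

/-- The set of reducts of `W`: the square-free words obtained from `W` by a finite
(possibly empty) sequence of square reductions. -/
def reducts {α : Type*} (W : List α) : Set (List α) :=
  {R | Relation.ReflTransGen SquareReduction W R ∧ IsSquareFree R}

/-- The prefix of length `m` of an infinite word. -/
def pref {α : Type*} (w : ℕ → α) (m : ℕ) : List α :=
  (List.range m).map w

/-- An infinite word is square-free if no finite factor of it is a square; equivalently, all of
its finite prefixes are square-free. -/
def IsInfSquareFree {α : Type*} (w : ℕ → α) : Prop :=
  ∀ m : ℕ, IsSquareFree (pref w m)

open Letter in
/-- `F = xabaxababx`. -/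
def F : List Letter := [x, a, b, a, x, a, b, a, b, x]

open Letter in
/-- `P = xabx`. -/
def P : List Letter := [x, a, b, x]

open Letter in
/-- `Q = xabaxabx`. -/
def Q : List Letter := [x, a, b, a, x, a, b, x]

/-- `w` is an infinite square-free word over `{a, b, y}` starting with `y`, and `n 1 < n 2 < ⋯`
are lengths of prefixes of `w` that end with `y` (so they are non-empty). The value `n 0` is not
used. -/
def Admissible (w : ℕ → Letter) (n : ℕ → ℕ) : Prop :=
  (∀ m, w m = Letter.a ∨ w m = Letter.b ∨ w m = Letter.y) ∧
  IsInfSquareFree w ∧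
  w 0 = Letter.y ∧
  StrictMonoOn n (Set.Ici 1) ∧
  ∀ j, 1 ≤ j → (pref w (n j)).getLast? = some Letter.y

/-- `S i = F W₁ F W₂ ⋯ F Wᵢ`, where `W_j` is the prefix of `w` of length `n j`. -/
def S (w : ℕ → Letter) (n : ℕ → ℕ) : ℕ → List Letter
  | 0 => []
  | i + 1 => S w n i ++ F ++ pref w (n (i + 1))

end SquareReduct

/-! Every word reachable from `S w n i` still splits into blocks `A W`, where `A` comes from `F`,
avoids `y` and has `x` at both ends, and `W` is some `W_j`, which avoids `x` and has `y` at both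
ends. The factor `yx` marks exactly the block boundaries, so there are three kinds of square
(`flat_square_cases`). A square lacking `x` or `y` lies inside one `A`, because the `W`s are
square-free. A square whose root contains `yx` is contracted by deleting whole blocks. Any other
square is centred on a boundary, and its contraction turns `A W A' W'`, with `A'` a suffix of `A`,
into `A W'`. None of these loses the final `W_i` or disturbs the order of the indices
(`IsReachable.reduction`).

`F` has two overlapping squares, and the choice of which to contract first ends in `P` or in `Q`. As
`W_j` is a prefix of `W_k` for `j < k`, adjacent blocks `A W_j A' W_k` contain the square of `A'
W_j` whenever `A'` is a suffix of `A`. Since `P` is a suffix of `Q`, only `P` followed by `Q`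
survives, so a reduct has at most two blocks. Conversely, all candidates are square-free by the same
classification, and are reached by merging equal-headed neighbours.

The required infinite word is the difference sequence of the overlap-free Thue–Morse sequence. -/

namespace SquareReduct

/-! ### Thue–Morse and an infinite square-free word on three letters -/

/-- The Thue–Morse sequence: the parity of the number of ones in the binary expansion. -/
def thueMorse (n : ℕ) : Bool :=
  if h : n = 0 then false else xor (n % 2 == 1) (thueMorse (n / 2))
termination_by n
decreasing_by omega

theorem thueMorse_two_mul (n : ℕ) : thueMorse (2 * n) = thueMorse n := by
  rcases Nat.eq_zero_or_pos n with rfl | h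
  · rfl
  · rw [thueMorse, dif_neg (by omega)]
    simp

theorem thueMorse_two_mul_add_one (n : ℕ) : thueMorse (2 * n + 1) = !thueMorse n := by
  rw [thueMorse, dif_neg (by omega), show (2 * n + 1) / 2 = n by omega,
    show (2 * n + 1) % 2 = 1 by omega]
  simp

/-- The Thue–Morse sequence has no overlap of odd period. -/
theorem thueMorse_no_odd_overlap (n p : ℕ) (hp : p % 2 = 1)
    (h : ∀ j ≤ p, thueMorse (n + j) = thueMorse (n + j + p)) : False := by
  have pair (m : ℕ) (hm : m % 2 = 0) : thueMorse (m + 1) = !thueMorse m := by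
    obtain ⟨k, rfl⟩ : ∃ k, m = 2 * k := ⟨m / 2, by omega⟩
    rw [thueMorse_two_mul, thueMorse_two_mul_add_one]
  -- As `p` is odd, one of `n + j` and `n + j + p` is even, and the overlap carries `pair` from one
  -- to the other. So the bits alternate over `p` steps and end flipped, against `h 0`.
  have alt (j : ℕ) (hj : j < p) : thueMorse (n + j + 1) = !thueMorse (n + j) := by
    rcases Nat.mod_two_eq_zero_or_one (n + j) with h0 | h1
    · exact pair _ h0
    · have e := pair (n + j + p) (by omega)
      rw [h j hj.le, ← e, add_assoc n j 1, h (j + 1) hj]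
      congr 1; ring
  have par (j : ℕ) (hj : j ≤ p) : thueMorse (n + j) = xor (j % 2 == 1) (thueMorse n) := by
    induction j with
    | zero => simp
    | succ j ih =>
      rw [← add_assoc, alt j hj, ih (by omega)]
      rcases Nat.mod_two_eq_zero_or_one j with h0 | h1
      · simp [h0, show (j + 1) % 2 = 1 by omega]
      · simp [h1, show (j + 1) % 2 = 0 by omega]
  have e := par p le_rfl
  have e0 := h 0 (Nat.zero_le _)
  simp only [add_zero] at e0
  rw [← e0, hp] at e
  simp at e

/-- The Thue–Morse sequence is overlap-free. -/
theorem thueMorse_overlap_free (p : ℕ) (hp : 0 < p) (n : ℕ)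
    (h : ∀ j ≤ p, thueMorse (n + j) = thueMorse (n + j + p)) : False := by
  induction p using Nat.strong_induction_on generalizing n with
  | _ p ih =>
    rcases Nat.mod_two_eq_zero_or_one p with h0 | h1
    · obtain ⟨q, rfl⟩ : ∃ q, p = 2 * q := ⟨p / 2, by omega⟩
      -- For even period, keeping only the positions of the parity of `n` gives an overlap of half
      -- the period in the sequence itself (complemented if `n` is odd).
      refine ih q (by omega) (by omega) (n / 2) fun j hj => ?_
      have e := h (2 * j) (by omega)
      rcases Nat.mod_two_eq_zero_or_one n with hn | hn
      · rw [show n + 2 * j = 2 * (n / 2 + j) by omega,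
          show 2 * (n / 2 + j) + 2 * q = 2 * (n / 2 + j + q) by omega,
          thueMorse_two_mul, thueMorse_two_mul] at e
        exact e
      · rw [show n + 2 * j = 2 * (n / 2 + j) + 1 by omega,
          show 2 * (n / 2 + j) + 1 + 2 * q = 2 * (n / 2 + j + q) + 1 by omega,
          thueMorse_two_mul_add_one, thueMorse_two_mul_add_one] at e
        simpa using e
    · exact thueMorse_no_odd_overlap n p h1 h

/-- Consecutive differences of the Thue–Morse sequence, as letters. -/
def thueLetter (n : ℕ) : Letter :=
  match thueMorse n, thueMorse (n + 1) with
  | false, true => .a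
  | true, false => .b
  | _, _ => .y

/-- The integer value of a letter that records a difference of bits. -/
def letterValue : Letter → ℤ
  | .a => 1
  | .b => -1
  | _ => 0

theorem letterValue_thueLetter (n : ℕ) :
    letterValue (thueLetter n) = (thueMorse (n + 1)).toNat - (thueMorse n).toNat := by
  unfold thueLetter
  cases thueMorse n <;> cases thueMorse (n + 1) <;> rfl

/-- The sequence of differences of the Thue–Morse sequence has no square. -/
theorem thueLetter_no_square (p : ℕ) (hp : 0 < p) (n : ℕ)
    (h : ∀ j < p, thueLetter (n + j) = thueLetter (n + j + p)) : False := by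
  have inj (b c : Bool) : (b.toNat : ℤ) = c.toNat → b = c := by
    cases b <;> cases c <;> simp
  -- Summing equal differences telescopes: the two halves of the square are bit strings differing by
  -- a constant.
  have shift (j : ℕ) (hj : j ≤ p) : ((thueMorse (n + j)).toNat : ℤ) - (thueMorse n).toNat =
      (thueMorse (n + j + p)).toNat - (thueMorse (n + p)).toNat := by
    induction j with
    | zero => simp
    | succ j ih =>
      have e := congrArg letterValue (h j hj)
      rw [letterValue_thueLetter, letterValue_thueLetter] at e
      have e1 := ih (by omega)
      rw [show n + (j + 1) + p = n + j + p + 1 by ring, ← add_assoc]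
      linarith
  -- The bits at `n`, `n + p`, `n + 2p` form an arithmetic progression in {0, 1}, hence a constant
  -- one; the square then lifts to an overlap.
  have base : thueMorse n = thueMorse (n + p) := by
    have e := shift p le_rfl
    revert e
    cases thueMorse n <;> cases thueMorse (n + p) <;> cases thueMorse (n + p + p) <;> simp
  refine thueMorse_overlap_free p hp n fun j hj => inj _ _ ?_
  have e := shift j hj
  rw [base] at e
  linarith

theorem thueLetter_ne_x (n : ℕ) : thueLetter n ≠ .x := by
  unfold thueLetter
  cases thueMorse n <;> cases thueMorse (n + 1) <;> simp

/-- The letter `y` occurs infinitely often. -/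
theorem exists_thueLetter_eq_y (n : ℕ) : ∃ m, n ≤ m ∧ thueLetter m = .y := by
  by_contra! hc
  have ne (m : ℕ) (hm : n ≤ m) : thueMorse (m + 1) = !thueMorse m := by
    have := hc m hm
    unfold thueLetter at this
    revert this
    cases thueMorse m <;> cases thueMorse (m + 1) <;> simp
  -- Without `y` the bits alternate from `n` on, which is an overlap of period 2.
  refine thueMorse_overlap_free 2 (by norm_num) n fun j _ => ?_
  rw [show n + j + 2 = n + j + 1 + 1 from rfl, ne (n + j + 1) (by omega), ne (n + j) (by omega)]
  simp

theorem pref_length {α : Type*} (w : ℕ → α) (m : ℕ) : (pref w m).length = m := by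
  simp [pref]

/-- An infinite word without two equal adjacent factors is square-free. -/
theorem isInfSquareFree_of_no_square {α : Type*} (w : ℕ → α)
    (h : ∀ p, 0 < p → ∀ n, ¬ ∀ j < p, w (n + j) = w (n + j + p)) : IsInfSquareFree w := by
  rintro m ⟨U, X, V, hX, e⟩
  have hlen := congrArg List.length e
  rw [pref_length] at hlen
  simp only [List.length_append] at hlen
  have get (k : ℕ) (hk : k < m) : (pref w m)[k]? = some (w k) := by
    simp [pref, hk]
  refine h X.length (List.length_pos_iff.2 hX) U.length fun j hj => ?_
  have e1 := get (U.length + j) (by omega)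
  have e2 := get (U.length + j + X.length) (by omega)
  rw [e, List.append_assoc, List.append_assoc, List.getElem?_append_right (by omega)] at e1 e2
  rw [List.getElem?_append_left (by omega)] at e1
  rw [List.getElem?_append_right (by omega), List.getElem?_append_left (by omega)] at e2
  rw [show U.length + j + X.length - U.length - X.length = U.length + j - U.length by omega, e1]
    at e2
  exact Option.some.inj e2

/-- The difference sequence is started at one of its `y`s and cut just after later ones; the length
is `φ j + 1` because the `y` at index `φ j` must be included. -/
theorem exists_admissible : ∃ (w : ℕ → Letter) (n : ℕ → ℕ), Admissible w n := by
  obtain ⟨s, -, hs⟩ := exists_thueLetter_eq_y 0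
  set w : ℕ → Letter := fun k => thueLetter (s + k) with hw
  have hinf (N : ℕ) : ∃ m > N, w m = .y := by
    obtain ⟨m, hm, e⟩ := exists_thueLetter_eq_y (s + N + 1)
    exact ⟨m - s, by omega, by rw [hw]; simpa [show s + (m - s) = m by omega] using e⟩
  obtain ⟨φ, hφ, hy⟩ := Nat.exists_strictMono_subsequence hinf
  refine ⟨w, fun j => φ j + 1, fun m => ?_, ?_, hs, ?_, fun j _ => ?_⟩
  · have := thueLetter_ne_x (s + m)
    change thueLetter (s + m) = _ ∨ thueLetter (s + m) = _ ∨ thueLetter (s + m) = _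
    revert this
    cases thueLetter (s + m) <;> simp
  · refine isInfSquareFree_of_no_square w fun p hp n h => ?_
    refine thueLetter_no_square p hp (s + n) fun j hj => ?_
    have := h j hj
    simpa [hw, add_assoc] using this
  · intro a _ b _ hab
    have := hφ hab
    simpa using this
  · simp [pref, List.range_succ, hy]


/-! ### Block decompositions and the classification of their squares -/

/-- The word `A₁W₁A₂W₂⋯` spelled by a list of pairs `(A₁, W₁), (A₂, W₂), …`. -/
def flat {α : Type*} (L : List (List α × List α)) : List α :=
  L.flatMap fun b => b.1 ++ b.2

@[simp] theorem flat_nil {α : Type*} : flat ([] : List (List α × List α)) = [] := rfl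

@[simp] theorem flat_cons {α : Type*} (b : List α × List α) (L : List (List α × List α)) :
    flat (b :: L) = b.1 ++ b.2 ++ flat L := by
  simp [flat]

@[simp] theorem flat_append {α : Type*} (L L' : List (List α × List α)) :
    flat (L ++ L') = flat L ++ flat L' := by
  simp [flat]

/-- A pair `(A, W)` where `A` avoids `y` and starts and ends with `x`, and `W` is square-free,
avoids `x` and starts and ends with `y`. -/
structure IsBlock (b : List Letter × List Letter) : Prop where
  y_notMem : .y ∉ b.1
  head_x : ∃ t, b.1 = .x :: t
  last_x : ∃ t, b.1 = t ++ [.x]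
  x_notMem : .x ∉ b.2
  head_y : ∃ t, b.2 = .y :: t
  last_y : ∃ t, b.2 = t ++ [.y]
  squareFree : IsSquareFree b.2

/-- The first component has no `y`, the second no `x`, and their junction reads `xy`. -/
theorem IsBlock.no_yx {b : List Letter × List Letter} (hb : IsBlock b) (U V : List Letter) :
    b.1 ++ b.2 ≠ U ++ .y :: .x :: V := by
  intro e
  rcases List.append_eq_append_iff.1 e with ⟨s, -, h⟩ | ⟨s, h, h'⟩
  · exact hb.x_notMem (by rw [h]; simp)
  · rcases s with _ | ⟨c, s⟩
    · exact hb.x_notMem (by rw [List.nil_append] at h'; rw [← h']; simp)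
    · obtain ⟨rfl, -⟩ := List.cons.inj h'
      exact hb.y_notMem (by rw [h]; simp)

theorem head_flat {L : List (List Letter × List Letter)} (hL : ∀ b ∈ L, IsBlock b)
    (h : L ≠ []) : ∃ t, flat L = .x :: t := by
  rcases L with _ | ⟨b, L⟩
  · exact absurd rfl h
  · obtain ⟨t, ht⟩ := (hL b (by simp)).head_x
    exact ⟨t ++ b.2 ++ flat L, by simp [ht]⟩

theorem last_flat {L : List (List Letter × List Letter)} (hL : ∀ b ∈ L, IsBlock b)
    (h : L ≠ []) : ∃ t, flat L = t ++ [.y] := by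
  rcases List.eq_nil_or_concat L with rfl | ⟨L, b, rfl⟩
  · exact absurd rfl h
  · obtain ⟨t, ht⟩ := (hL b (by simp)).last_y
    exact ⟨flat L ++ b.1 ++ t, by simp [ht]⟩

/-- A factor `yx` of a word spelled by blocks only occurs where two blocks meet. -/
theorem cut_flat {L : List (List Letter × List Letter)} (hL : ∀ b ∈ L, IsBlock b)
    {U V : List Letter} (e : flat L = (U ++ [.y]) ++ (.x :: V)) :
    ∃ L₁ L₂, L = L₁ ++ L₂ ∧ flat L₁ = U ++ [.y] ∧ flat L₂ = .x :: V := by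
  induction L generalizing U with
  | nil => simp at e
  | cons b L ih =>
    have hb := hL b (by simp)
    rw [flat_cons] at e
    rcases List.append_eq_append_iff.1 e with ⟨s, h, h'⟩ | ⟨s, h, h'⟩
    · rcases List.eq_nil_or_concat s with rfl | ⟨s, c, rfl⟩
      · exact ⟨[b], L, rfl, by simpa using h.symm, by simpa using h'⟩
      · rw [List.concat_eq_append, ← List.append_assoc] at h
        obtain ⟨h1, h2⟩ := List.append_inj' h rfl
        obtain rfl : Letter.y = c := by simpa using h2
        rw [List.concat_eq_append] at h'
        obtain ⟨L₁, L₂, rfl, e1, e2⟩ := ih (fun b hb => hL b (by simp [hb])) h'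
        exact ⟨b :: L₁, L₂, rfl, by simp [e1, h1], e2⟩
    · rcases s with _ | ⟨c, s⟩
      · exact ⟨[b], L, rfl, by simpa using h, by simpa using h'.symm⟩
      · obtain ⟨rfl, -⟩ := List.cons.inj h'
        exact absurd (by simpa using h) (hb.no_yx U s)

/-- In a word spelled by blocks, a `y` and a later `x` are separated by a factor `yx`. -/
theorem exists_yx {L : List (List Letter × List Letter)} (hL : ∀ b ∈ L, IsBlock b)
    {U M V : List Letter} (e : flat L = U ++ (.y :: M ++ .x :: V)) :
    ∃ M₁ M₂, .y :: M ++ [.x] = M₁ ++ [.y] ++ .x :: M₂ := by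
  induction L generalizing U with
  | nil => simp at e
  | cons b L ih =>
    have hb := hL b (by simp)
    have hL' : ∀ c ∈ L, IsBlock c := fun c hc => hL c (by simp [hc])
    rw [flat_cons] at e
    rcases List.append_eq_append_iff.1 e with ⟨s, h, h'⟩ | ⟨s, h, h'⟩
    · exact ih hL' h'
    · rcases s with _ | ⟨c, s⟩
      · exact ih hL' (U := []) (by simpa using h'.symm)
      · obtain ⟨rfl, -⟩ := List.cons.inj h'
        have hs : ∃ s', b.2 = s' ++ .y :: s := by
          rcases List.append_eq_append_iff.1 h with ⟨r, -, h2⟩ | ⟨r, h1, h2⟩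
          · exact ⟨r, h2⟩
          · rcases r with _ | ⟨c, r⟩
            · exact ⟨[], by simpa using h2.symm⟩
            · obtain ⟨rfl, -⟩ := List.cons.inj h2
              exact absurd (by rw [h1]; simp) hb.y_notMem
        obtain ⟨s', hs⟩ := hs
        -- From this `y` on, the second component has no `x` and ends with `y`, so the next `x`
        -- opens the following block and completes a `yx`.
        have hx : Letter.x ∉ Letter.y :: s := fun hx =>
          hb.x_notMem (by rw [hs]; exact List.mem_append_right _ hx)
        obtain ⟨t, ht⟩ : ∃ t, Letter.y :: s = t ++ [.y] := by
          obtain ⟨t, ht⟩ := hb.last_y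
          rw [hs] at ht
          rcases List.eq_nil_or_concat s with rfl | ⟨s, c, rfl⟩
          · exact ⟨[], rfl⟩
          · rw [List.concat_eq_append, ← List.cons_append, ← List.append_assoc] at ht
            obtain ⟨-, h2⟩ := List.append_inj' ht rfl
            exact ⟨.y :: s, by simpa using h2⟩
        rcases List.append_eq_append_iff.1 h' with ⟨r, h1, h2⟩ | ⟨r, h1, h2⟩
        · rcases r with _ | ⟨c, r⟩
          · rw [List.nil_append] at h2
            exact ⟨t, [], by rw [← ht, h1]; simp⟩
          · obtain ⟨rfl, -⟩ := List.cons.inj h2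
            exact absurd (by rw [h1]; simp) hx
        · rcases r with _ | ⟨c, r⟩
          · exact ⟨t, [], by rw [← ht, h1]; simp⟩
          · have hne : L ≠ [] := by rintro rfl; simp at h2
            obtain ⟨u, hu⟩ := head_flat hL' hne
            rw [hu] at h2
            obtain ⟨rfl, -⟩ := List.cons.inj h2
            exact ⟨t, r ++ [.x], by rw [h1, ht]; simp⟩

/-- A factor avoiding `x` or `y` of a word spelled by blocks lies inside a component of a block. -/
theorem localize_flat {L : List (List Letter × List Letter)} (hL : ∀ b ∈ L, IsBlock b)
    {U Y V : List Letter} (hne : Y ≠ []) (hY : .x ∉ Y ∨ .y ∉ Y) (e : flat L = U ++ (Y ++ V)) :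
    ∃ L₁ b L₂ U' V', L = L₁ ++ b :: L₂ ∧
      (b.1 = U' ++ Y ++ V' ∧ U = flat L₁ ++ U' ∧ V = V' ++ b.2 ++ flat L₂ ∨
        b.2 = U' ++ Y ++ V') := by
  induction L generalizing U with
  | nil => simp [hne] at e
  | cons b L ih =>
    have hb := hL b (by simp)
    have hL' : ∀ c ∈ L, IsBlock c := fun c hc => hL c (by simp [hc])
    have step {U₁ : List Letter} (hU : U = b.1 ++ b.2 ++ U₁) (e : flat L = U₁ ++ (Y ++ V)) :
        ∃ L₁ c L₂ U' V', b :: L = L₁ ++ c :: L₂ ∧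
          (c.1 = U' ++ Y ++ V' ∧ U = flat L₁ ++ U' ∧ V = V' ++ c.2 ++ flat L₂ ∨
            c.2 = U' ++ Y ++ V') := by
      obtain ⟨L₁, c, L₂, U', V', rfl, h⟩ := ih hL' e
      refine ⟨b :: L₁, c, L₂, U', V', rfl, h.imp_left ?_⟩
      rintro ⟨h1, h2, h3⟩
      exact ⟨h1, by rw [hU, h2]; simp, h3⟩
    rw [flat_cons, List.append_assoc] at e
    -- Both kinds of junction, `xy` inside a block and `yx` between blocks, contain both letters, so
    -- `Y` cannot straddle either; the impossible cases below are these.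
    obtain ⟨t₁, ht₁⟩ := hb.last_x
    obtain ⟨t₂, ht₂⟩ := hb.head_y
    obtain ⟨t₃, ht₃⟩ := hb.last_y
    rcases List.append_eq_append_iff.1 e with ⟨s, h, h'⟩ | ⟨s, h, h'⟩
    · rcases List.append_eq_append_iff.1 h' with ⟨r, h1, h2⟩ | ⟨r, h1, h2⟩
      · exact step (U₁ := r) (by rw [h, h1]; simp) h2
      · rcases List.append_eq_append_iff.1 h2 with ⟨q, h3, h4⟩ | ⟨q, h3, h4⟩
        · exact ⟨[], b, L, s, q, rfl, .inr (by rw [h1, h3]; simp)⟩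
        · rcases List.eq_nil_or_concat r with rfl | ⟨r, c, rfl⟩
          · exact step (U₁ := []) (by rw [h, h1]; simp) (by simpa using h2.symm)
          · rcases q with _ | ⟨c', q⟩
            · exact ⟨[], b, L, s, [], rfl, .inr (by rw [h1, h3]; simp)⟩
            · exfalso
              have hne : L ≠ [] := by rintro rfl; simp at h4
              obtain ⟨u, hu⟩ := head_flat hL' hne
              rw [hu] at h4
              obtain ⟨rfl, -⟩ := List.cons.inj h4
              rw [ht₃, List.concat_eq_append, ← List.append_assoc] at h1
              obtain ⟨-, h5⟩ := List.append_inj' h1 rfl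
              obtain rfl : Letter.y = c := by simpa using h5
              rw [h3] at hY
              simp at hY
    · rcases List.append_eq_append_iff.1 h' with ⟨r, h1, h2⟩ | ⟨r, h1, h2⟩
      · exact ⟨[], b, L, U, r, rfl, .inl ⟨by rw [h, h1]; simp, by simp, by rw [h2]; simp⟩⟩
      · rcases r with _ | ⟨c', r⟩
        · exact ⟨[], b, L, U, [], rfl,
            .inl ⟨by rw [h, h1]; simp, by simp, by simpa using h2.symm⟩⟩
        · rw [ht₂] at h2
          obtain ⟨rfl, h2⟩ := List.cons.inj h2
          rcases List.eq_nil_or_concat s with rfl | ⟨s, c, rfl⟩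
          · rw [List.nil_append] at h1
            have h3 : b.2 ++ flat L = Y ++ V := by simpa using h'.symm
            rcases List.append_eq_append_iff.1 h3 with ⟨q, h4, h5⟩ | ⟨q, h4, h5⟩
            · rcases q with _ | ⟨d, q⟩
              · exact ⟨[], b, L, [], [], rfl, .inr (by rw [h4]; simp)⟩
              · exfalso
                have hne : L ≠ [] := by rintro rfl; simp at h5
                obtain ⟨u, hu⟩ := head_flat hL' hne
                rw [hu] at h5
                obtain ⟨rfl, -⟩ := List.cons.inj h5
                rw [h4, ht₃] at hY
                simp at hY
            · exact ⟨[], b, L, [], q, rfl, .inr (by rw [h4]; simp)⟩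
          · exfalso
            rw [ht₁, List.concat_eq_append, ← List.append_assoc] at h
            obtain ⟨-, h5⟩ := List.append_inj' h rfl
            obtain rfl : Letter.x = c := by simpa using h5
            rw [h1] at hY
            simp at hY

/-- Two words split at their first `y` agree on both sides of it. -/
theorem append_inj_of_notMem_y {s s' t t' : List Letter} (hs : .y ∉ s) (hs' : .y ∉ s')
    (e : s ++ .y :: t = s' ++ .y :: t') : s = s' ∧ t = t' := by
  rcases List.append_eq_append_iff.1 e with ⟨r, h1, h2⟩ | ⟨r, h1, h2⟩
  · rcases r with _ | ⟨c, r⟩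
    · simp_all
    · obtain ⟨rfl, -⟩ := List.cons.inj h2
      exact absurd (by rw [h1]; simp) hs'
  · rcases r with _ | ⟨c, r⟩
    · simp_all
    · obtain ⟨rfl, -⟩ := List.cons.inj h2
      exact absurd (by rw [h1]; simp) hs

/-- A square starting with `x`, ending with `y` and without inner factor `yx` in its root, around
the meeting point of two lists of blocks, merges the two blocks that meet. -/
theorem merge_of_square {L₁ L₂ : List (List Letter × List Letter)}
    (hL₁ : ∀ b ∈ L₁, IsBlock b) (hL₂ : ∀ b ∈ L₂, IsBlock b) {U X V : List Letter}
    (hx : ∃ t, X = .x :: t) (hy : ∃ t, X = t ++ [.y])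
    (hyx : ∀ M₁ M₂, X ≠ M₁ ++ [.y] ++ .x :: M₂)
    (e₁ : flat L₁ = U ++ X) (e₂ : flat L₂ = X ++ V) :
    ∃ L₁' A A' W W' L₂', L₁ = L₁' ++ [(A, W)] ∧ L₂ = (A', W') :: L₂' ∧ A' <:+ A ∧
      U ++ X ++ V = flat (L₁' ++ (A, W') :: L₂') := by
  obtain ⟨tx, hx⟩ := hx
  obtain ⟨ty, hy⟩ := hy
  rcases List.eq_nil_or_concat L₁ with rfl | ⟨L₁', ⟨A, W⟩, rfl⟩
  · simp [hx] at e₁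
  rcases L₂ with _ | ⟨⟨A', W'⟩, L₂'⟩
  · simp [hx] at e₂
  rw [List.concat_eq_append] at e₁ hL₁ ⊢
  have hb := hL₁ (A, W) (by simp)
  have hb' := hL₂ (A', W') (by simp)
  have hL₁' : ∀ b ∈ L₁', IsBlock b := fun c hc => hL₁ c (by simp [hc])
  have hL₂' : ∀ b ∈ L₂', IsBlock b := fun c hc => hL₂ c (by simp [hc])
  obtain ⟨tA, hA⟩ := hb.head_x
  obtain ⟨tA', hA'⟩ := hb'.head_x
  obtain ⟨tW, hW⟩ := hb.head_y
  obtain ⟨tW', hW'⟩ := hb'.head_y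
  obtain ⟨lW', hlW'⟩ := hb'.last_y
  dsimp only at hA hA' hW hW' hlW'
  -- `X` starts inside the last block of `L₁`: reaching further left it would contain the boundary
  -- `yx`. Symmetrically, the second copy stays in the first block of `L₂`.
  obtain ⟨τ, hU, hτ⟩ : ∃ τ, U = flat L₁' ++ τ ∧ A ++ W = τ ++ X := by
    rw [flat_append, flat_cons, flat_nil, List.append_nil] at e₁
    rcases List.append_eq_append_iff.1 e₁ with ⟨s, h, h'⟩ | ⟨s, h, h'⟩
    · exact ⟨s, h, h'⟩
    · rcases List.eq_nil_or_concat s with rfl | ⟨s, c, rfl⟩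
      · exact ⟨[], by simpa using h.symm, by simpa using h'.symm⟩
      · exfalso
        have hne : L₁' ≠ [] := by rintro rfl; simp at h
        obtain ⟨u, hu⟩ := last_flat hL₁' hne
        rw [hu, List.concat_eq_append, ← List.append_assoc] at h
        obtain ⟨-, h5⟩ := List.append_inj' h rfl
        obtain rfl : Letter.y = c := by simpa using h5
        exact hyx s (tA ++ W) (by rw [h']; simp [hA])
  obtain ⟨π, hπ⟩ : ∃ π, A' ++ W' = X ++ π := by
    rw [flat_cons] at e₂
    rcases List.append_eq_append_iff.1 e₂ with ⟨s, h, h'⟩ | ⟨s, h, h'⟩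
    · rcases s with _ | ⟨c, s⟩
      · exact ⟨[], by simpa using h.symm⟩
      · exfalso
        have hne : L₂' ≠ [] := by rintro rfl; simp at h'
        obtain ⟨u, hu⟩ := head_flat hL₂' hne
        rw [hu] at h'
        obtain ⟨rfl, -⟩ := List.cons.inj h'
        exact hyx (A' ++ lW') s (by rw [h]; simp [hlW'])
    · exact ⟨s, h⟩
  -- `X` begins with `x`, which `W` lacks, so it begins inside `A`.
  obtain ⟨σ, hσ, hXσ⟩ : ∃ σ, A = τ ++ σ ∧ X = σ ++ W := by
    rcases List.append_eq_append_iff.1 hτ with ⟨s, h, h'⟩ | ⟨s, h, h'⟩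
    · exact absurd (by dsimp only; rw [h', hx]; simp) hb.x_notMem
    · exact ⟨s, h, h'⟩
  obtain ⟨ρ, hXρ, hWρ⟩ : ∃ ρ, X = A' ++ ρ ∧ W' = ρ ++ π := by
    rcases List.append_eq_append_iff.1 hπ with ⟨s, h, h'⟩ | ⟨s, h, h'⟩
    · exact ⟨s, h, h'⟩
    · exact absurd (by dsimp only; rw [h, hy]; simp) hb'.y_notMem
  have hσy : Letter.y ∉ σ := fun h => hb.y_notMem (by dsimp only; rw [hσ]; simp [h])
  obtain ⟨tρ, hρ⟩ : ∃ t, ρ = .y :: t := by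
    rcases ρ with _ | ⟨c, t⟩
    · exact absurd (by dsimp only; rw [← List.append_nil A', ← hXρ, hy]; simp) hb'.y_notMem
    · rw [hW'] at hWρ
      obtain ⟨rfl, -⟩ := List.cons.inj hWρ
      exact ⟨t, rfl⟩
  -- Both `σ W` and `A' ρ` spell `X`; cutting at the first `y` identifies `A'` with the suffix `σ`
  -- of `A`.
  obtain ⟨rfl, -⟩ : σ = A' ∧ tW = tρ :=
    append_inj_of_notMem_y hσy hb'.y_notMem (by rw [← hW, ← hρ, ← hXσ, hXρ])
  refine ⟨L₁', A, σ, W, W', L₂', rfl, rfl, ⟨τ, hσ.symm⟩, ?_⟩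
  rw [List.append_assoc, ← e₂, hU, hσ]
  simp

/-- Classification of the square reductions of a word spelled by blocks. -/
theorem flat_square_cases {L : List (List Letter × List Letter)} (hL : ∀ b ∈ L, IsBlock b)
    {T : List Letter} (h : SquareReduction (flat L) T) :
    (∃ L₁ A A' W L₂, L = L₁ ++ (A, W) :: L₂ ∧ SquareReduction A A' ∧
      T = flat (L₁ ++ (A', W) :: L₂)) ∨
    (∃ L₁ L₂ L₃, L = L₁ ++ (L₂ ++ L₃) ∧ L₁ ≠ [] ∧ L₂ ≠ [] ∧ L₃ ≠ [] ∧ T = flat (L₁ ++ L₃)) ∨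
    (∃ L₁ A A' W W' L₂, L = L₁ ++ (A, W) :: (A', W') :: L₂ ∧ A' <:+ A ∧
      T = flat (L₁ ++ (A, W') :: L₂)) := by
  obtain ⟨U, X, V, hX, e, rfl⟩ := h
  by_cases hxy : .x ∉ X ∨ .y ∉ X
  · left
    obtain ⟨L₁, ⟨A, W⟩, L₂, U', V', rfl, ⟨h1, rfl, rfl⟩ | h1⟩ :=
      localize_flat hL (U := U) (Y := X ++ X) (V := V) (by simp [hX]) (by simpa using hxy)
        (by simpa using e)
    · exact ⟨L₁, A, U' ++ X ++ V', W, L₂, rfl, ⟨U', X, V', hX, by simpa using h1, rfl⟩,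
        by simp⟩
    · exact absurd ⟨U', X, V', hX, by simpa using h1⟩ (hL (A, W) (by simp)).squareFree
  · push Not at hxy
    obtain ⟨hx, hy⟩ := hxy
    right
    -- Cutting at the `yx` in each copy of `X` isolates blocks spelling `x M₂ M₁ y`, a conjugate of
    -- `X`; contracting the square amounts to deleting them.
    have inner (M₁ M₂ : List Letter) (hM : X = M₁ ++ [.y] ++ .x :: M₂) :
        ∃ L₁ L₂ L₃, L = L₁ ++ (L₂ ++ L₃) ∧ L₁ ≠ [] ∧ L₂ ≠ [] ∧ L₃ ≠ [] ∧
          U ++ X ++ V = flat (L₁ ++ L₃) := by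
      obtain ⟨L₁, R, rfl, h1, h2⟩ := cut_flat hL (U := U ++ M₁) (V := M₂ ++ X ++ V)
        (by rw [e]; nth_rw 1 [hM]; simp)
      obtain ⟨L₂, L₃, rfl, h3, h4⟩ := cut_flat (fun b hb => hL b (List.mem_append_right _ hb))
        (U := .x :: M₂ ++ M₁) (V := M₂ ++ V) (by rw [h2, hM]; simp)
      refine ⟨L₁, L₂, L₃, rfl, ?_, ?_, ?_, ?_⟩
      · rintro rfl; simp at h1
      · rintro rfl; simp at h3
      · rintro rfl; simp at h4
      · rw [flat_append, h1, h4, hM]; simp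
    by_cases hyx : ∃ M₁ M₂, X = M₁ ++ [.y] ++ .x :: M₂
    · obtain ⟨M₁, M₂, hM⟩ := hyx
      exact .inl (inner M₁ M₂ hM)
    · push Not at hyx
      right
      -- A `y` of the first copy and an `x` of the second force a `yx` in between. `X` itself has
      -- none, so it sits at the centre: `X` starts with `x` and ends with `y`.
      obtain ⟨X₁, X₂, h1⟩ := List.append_of_mem hy
      obtain ⟨X₃, X₄, h2⟩ := List.append_of_mem hx
      obtain ⟨M₁, M₂, hM⟩ := exists_yx hL (U := U ++ X₁) (M := X₂ ++ X₃) (V := X₄ ++ V) (by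
        rw [e]; nth_rw 1 [h1]; rw [h2]; simp)
      have hXX : X ++ X = (X₁ ++ M₁ ++ [.y]) ++ (.x :: (M₂ ++ X₄)) := by
        have : X ++ X = X₁ ++ (.y :: (X₂ ++ X₃) ++ [.x]) ++ X₄ := by
          nth_rw 1 [h1]; rw [h2]; simp
        rw [this, hM]; simp
      obtain ⟨hXy, hXx⟩ : X = X₁ ++ M₁ ++ [.y] ∧ X = .x :: (M₂ ++ X₄) := by
        rcases List.append_eq_append_iff.1 hXX with ⟨s, h, h'⟩ | ⟨s, h, h'⟩
        · rcases List.eq_nil_or_concat s with rfl | ⟨s, c, rfl⟩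
          · exact ⟨by simpa using h.symm, by simpa using h'⟩
          · rw [List.concat_eq_append, ← List.append_assoc] at h
            obtain ⟨-, h5⟩ := List.append_inj' h rfl
            obtain rfl : Letter.y = c := by simpa using h5
            exact absurd (by rw [h']; simp) (hyx s (M₂ ++ X₄))
        · rcases s with _ | ⟨c, s⟩
          · exact ⟨by simpa using h, by simpa using h'.symm⟩
          · obtain ⟨rfl, -⟩ := List.cons.inj h'
            exact absurd h (hyx _ s)
      obtain ⟨L₁, L₂, rfl, h3, h4⟩ := cut_flat hL (U := U ++ (X₁ ++ M₁)) (V := M₂ ++ X₄ ++ V)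
        (by rw [e, List.append_assoc (U ++ X)]; nth_rw 1 [hXy]; nth_rw 1 [hXx]; simp)
      obtain ⟨L₁', A, A', W, W', L₂', rfl, rfl, h5, h6⟩ :=
        merge_of_square (fun b hb => hL b (List.mem_append_left _ hb))
          (fun b hb => hL b (List.mem_append_right _ hb)) ⟨_, hXx⟩ ⟨_, hXy⟩ hyx (U := U) (V := V) (by rw [h3]; nth_rw 1 [hXy]; simp)
          (by rw [h4]; nth_rw 1 [hXx]; simp)
      exact ⟨L₁', A, A', W, W', L₂', by simp, h5, h6⟩


/-! ### Reductions of the word F -/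

/-- The words reachable from `F` by square reductions. -/
def fReach : List (List Letter) := [F, [.x, .a, .b, .a, .b, .x], P, Q]

/-- A square reduction is determined by the position and the length of the root. -/
theorem SquareReduction.exists_take_drop {α : Type*} {A A' : List α} (h : SquareReduction A A') :
    ∃ k ∈ List.range (A.length + 1), ∃ p ∈ List.range (A.length + 1), 0 < p ∧
      (A.drop k).take p = (A.drop (k + p)).take p ∧ k + p + p ≤ A.length ∧
      A' = A.take k ++ A.drop (k + p) := by
  obtain ⟨U, X, V, hX, rfl, rfl⟩ := h
  refine ⟨U.length, ?_, X.length, ?_, List.length_pos_iff.2 hX, ?_, ?_, ?_⟩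
  · simp only [List.mem_range, List.length_append]; omega
  · simp only [List.mem_range, List.length_append]; omega
  · simp [List.drop_append, List.take_append]
  · simp; omega
  · simp [List.drop_append]

/-- An exhaustive finite check. The only squares of `F` are those of `xaba` and of the later `ab`;
contracting the first leaves `xababx`, which reduces only to `P`, and contracting the second gives
`Q`. -/
theorem fReach_reduction {A A' : List Letter} (hA : A ∈ fReach) (h : SquareReduction A A') :
    A' ∈ fReach := by
  have key : ∀ A ∈ fReach, ∀ k ∈ List.range (A.length + 1), ∀ p ∈ List.range (A.length + 1),
      0 < p → (A.drop k).take p = (A.drop (k + p)).take p → k + p + p ≤ A.length →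
        A.take k ++ A.drop (k + p) ∈ fReach := by
    decide
  obtain ⟨k, hk, p, hp, h0, h1, h2, rfl⟩ := h.exists_take_drop
  exact key A hA k hk p hp h0 h1 h2

/-- This lets the classification of reductions serve also to prove square-freeness. -/
theorem isSquareFree_of_no_reduction {α : Type*} {A : List α}
    (h : ∀ A', ¬ SquareReduction A A') : IsSquareFree A := by
  rintro ⟨U, X, V, hX, e⟩
  exact h (U ++ X ++ V) ⟨U, X, V, hX, e, rfl⟩

theorem IsSquareFree.no_reduction {α : Type*} {A A' : List α} (h : IsSquareFree A) :
    ¬ SquareReduction A A' := by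
  rintro ⟨U, X, V, hX, e, -⟩
  exact h ⟨U, X, V, hX, e⟩

theorem IsSquareFree.of_factor {α : Type*} {A U V : List α} (h : IsSquareFree (U ++ A ++ V)) :
    IsSquareFree A := by
  rintro ⟨U', X, V', hX, rfl⟩
  exact h ⟨U ++ U', X, V' ++ V, hX, by simp⟩

theorem isSquareFree_P_Q {A : List Letter} (hA : A = P ∨ A = Q) : IsSquareFree A := by
  refine isSquareFree_of_no_reduction fun A' h => ?_
  have key : ∀ A ∈ [P, Q], ∀ k ∈ List.range (A.length + 1), ∀ p ∈ List.range (A.length + 1),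
      0 < p → (A.drop k).take p = (A.drop (k + p)).take p → ¬ k + p + p ≤ A.length := by
    decide
  obtain ⟨k, hk, p, hp, h0, h1, h2, -⟩ := h.exists_take_drop
  exact key A (by simpa using hA) k hk p hp h0 h1 h2

theorem eq_P_or_Q {A : List Letter} (hA : A ∈ fReach) (h : IsSquareFree A) : A = P ∨ A = Q := by
  simp only [fReach, List.mem_cons, List.not_mem_nil, or_false] at hA
  rcases hA with rfl | rfl | rfl | rfl
  · exact absurd ⟨[], [.x, .a, .b, .a], [.b, .x], by simp, rfl⟩ h
  · exact absurd ⟨[.x], [.a, .b], [.x], by simp, rfl⟩ h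
  · exact .inl rfl
  · exact .inr rfl

theorem F_to_P : Relation.ReflTransGen SquareReduction F P :=
  .tail (.single ⟨[], [.x, .a, .b, .a], [.b, .x], by simp, rfl, rfl⟩)
    ⟨[.x], [.a, .b], [.x], by simp, rfl, rfl⟩

theorem F_to_Q : Relation.ReflTransGen SquareReduction F Q :=
  .single ⟨[.x, .a, .b, .a, .x], [.a, .b], [.x], by simp, rfl, rfl⟩

/-- Reductions may be carried out inside a longer word. -/
theorem reflTransGen_context {α : Type*} (U V : List α) {A A' : List α}
    (h : Relation.ReflTransGen SquareReduction A A') :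
    Relation.ReflTransGen SquareReduction (U ++ A ++ V) (U ++ A' ++ V) := by
  refine Relation.ReflTransGen.lift (fun A => U ++ A ++ V) ?_ _ _ h
  rintro _ _ ⟨U', X, V', hX, rfl, rfl⟩
  exact ⟨U ++ U', X, V' ++ V, hX, by simp, by simp⟩

/-! ### The shape of reachable words -/

/-- The list `W₁, …, Wᵢ`. -/
def prefixes (w : ℕ → Letter) (n : ℕ → ℕ) (i : ℕ) : List (List Letter) :=
  (List.range i).map fun j => pref w (n (j + 1))

theorem prefixes_succ (w : ℕ → Letter) (n : ℕ → ℕ) (i : ℕ) :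
    prefixes w n (i + 1) = prefixes w n i ++ [pref w (n (i + 1))] := by
  simp [prefixes, List.range_succ]

theorem S_eq_flat (w : ℕ → Letter) (n : ℕ → ℕ) (i : ℕ) :
    S w n i = flat ((prefixes w n i).map fun W => (F, W)) := by
  induction i with
  | zero => rfl
  | succ i ih => rw [S, ih, prefixes_succ]; simp

theorem mem_prefixes {w : ℕ → Letter} {n : ℕ → ℕ} {i : ℕ} {W : List Letter} :
    W ∈ prefixes w n i ↔ ∃ j, 1 ≤ j ∧ j ≤ i ∧ W = pref w (n j) := by
  simp only [prefixes, List.mem_map, List.mem_range]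
  constructor
  · rintro ⟨j, hj, rfl⟩
    exact ⟨j + 1, by omega, by omega, rfl⟩
  · rintro ⟨j, h1, h2, rfl⟩
    exact ⟨j - 1, by omega, by rw [Nat.sub_add_cancel h1]⟩

/-- Being pairwise, this passes to sublists: the surviving `W`s always have strictly increasing
indices. -/
theorem pairwise_prefixes (w : ℕ → Letter) (n : ℕ → ℕ) (i : ℕ) :
    (prefixes w n i).Pairwise fun V W =>
      ∃ j k, 1 ≤ j ∧ j < k ∧ k ≤ i ∧ V = pref w (n j) ∧ W = pref w (n k) := by
  induction i with
  | zero => simp [prefixes]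
  | succ i ih =>
    rw [prefixes_succ, List.pairwise_append]
    refine ⟨ih.imp ?_, by simp, ?_⟩
    · rintro V W ⟨j, k, h1, h2, h3, h⟩
      exact ⟨j, k, h1, h2, by omega, h⟩
    · intro V hV W hW
      obtain ⟨j, h1, h2, rfl⟩ := mem_prefixes.1 hV
      exact ⟨j, i + 1, h1, by omega, le_rfl, rfl, by simpa using hW⟩

theorem pref_prefix {α : Type*} (w : ℕ → α) {m m' : ℕ} (h : m ≤ m') :
    pref w m <+: pref w m' := by
  obtain ⟨d, rfl⟩ := Nat.exists_eq_add_of_le h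
  exact ⟨(List.range d).map fun k => w (m + k), by simp [pref, List.range_add]⟩

theorem isBlock_pref {w : ℕ → Letter} {n : ℕ → ℕ} (hw : Admissible w n) {j : ℕ} (hj : 1 ≤ j)
    {A : List Letter} (hA : A ∈ fReach) : IsBlock (A, pref w (n j)) := by
  obtain ⟨hx, hsf, h0, -, hlast⟩ := hw
  have hl := hlast j hj
  simp only [fReach, List.mem_cons, List.not_mem_nil, or_false] at hA
  refine ⟨?_, ?_, ?_, ?_, ?_, ?_, hsf _⟩
  · rcases hA with rfl | rfl | rfl | rfl <;> simp [F, P, Q]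
  · rcases hA with rfl | rfl | rfl | rfl <;> exact ⟨_, rfl⟩
  · rcases hA with rfl | rfl | rfl | rfl
    exacts [⟨[.x, .a, .b, .a, .x, .a, .b, .a, .b], rfl⟩, ⟨[.x, .a, .b, .a, .b], rfl⟩,
      ⟨[.x, .a, .b], rfl⟩, ⟨[.x, .a, .b, .a, .x, .a, .b], rfl⟩]
  · simp only [pref, List.mem_map, not_exists, not_and]
    intro m _ hm
    simpa [hm] using hx m
  · dsimp only
    rcases hn : n j with _ | m
    · simp [hn, pref] at hl
    · exact ⟨_, by rw [pref, List.range_succ_eq_map, List.map_cons, h0]⟩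
  · dsimp only
    rw [List.getLast?_eq_some_iff] at hl
    exact hl

/-- The shape of all words reachable from `S w n i`: the words spelled by blocks `(A, W)` where `A`
is reachable from `F` and the `W` are a subsequence of `W₁, …, Wᵢ` that contains `Wᵢ`. -/
structure IsReachable (w : ℕ → Letter) (n : ℕ → ℕ) (i : ℕ)
    (L : List (List Letter × List Letter)) : Prop where
  fst_mem : ∀ b ∈ L, b.1 ∈ fReach
  sublist : (L.map Prod.snd).Sublist (prefixes w n i)
  last : (L.map Prod.snd).getLast? = some (pref w (n i))

namespace IsReachable

variable {w : ℕ → Letter} {n : ℕ → ℕ} {i : ℕ} {L : List (List Letter × List Letter)}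

theorem snd_mem (h : IsReachable w n i L) {b : List Letter × List Letter} (hb : b ∈ L) :
    b.2 ∈ prefixes w n i :=
  h.sublist.subset (List.mem_map_of_mem hb)

theorem isBlock (hw : Admissible w n) (h : IsReachable w n i L) : ∀ b ∈ L, IsBlock b := by
  rintro ⟨A, W⟩ hb
  obtain ⟨j, h1, -, rfl⟩ : ∃ j, 1 ≤ j ∧ j ≤ i ∧ W = pref w (n j) := mem_prefixes.1 (h.snd_mem hb)
  exact isBlock_pref hw h1 (h.fst_mem _ hb)

/-- Each of the three kinds of reduction keeps the last `W`: a deletion leaves blocks to its right,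
and a merge keeps the right-hand `W'`. -/
theorem reduction (hw : Admissible w n) (h : IsReachable w n i L) {T : List Letter}
    (hT : SquareReduction (flat L) T) : ∃ L', IsReachable w n i L' ∧ T = flat L' := by
  rcases flat_square_cases (h.isBlock hw) hT with ⟨L₁, A, A', W, L₂, rfl, hA, rfl⟩ |
    ⟨L₁, L₂, L₃, rfl, -, -, h3, rfl⟩ | ⟨L₁, A, A', W, W', L₂, rfl, -, rfl⟩
  · refine ⟨_, ⟨fun b hb => ?_, by simpa using h.sublist, by simpa using h.last⟩, rfl⟩
    simp only [List.mem_append, List.mem_cons] at hb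
    rcases hb with hb | rfl | hb
    · exact h.fst_mem b (by simp [hb])
    · exact fReach_reduction (h.fst_mem (A, W) (by simp)) hA
    · exact h.fst_mem b (by simp [hb])
  · refine ⟨_, ⟨fun b hb => ?_, ?_, ?_⟩, rfl⟩
    · simp only [List.mem_append] at hb
      exact h.fst_mem b (by simp only [List.mem_append]; tauto)
    · refine List.Sublist.trans ?_ h.sublist
      exact List.Sublist.map _
        ((List.Sublist.refl L₁).append (List.sublist_append_right L₂ L₃))
    · have := h.last
      obtain ⟨L₃, c, rfl⟩ := (List.eq_nil_or_concat L₃).resolve_left h3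
      simpa [← List.append_assoc] using this
  · refine ⟨_, ⟨fun b hb => ?_, ?_, ?_⟩, rfl⟩
    · simp only [List.mem_append, List.mem_cons] at hb
      rcases hb with hb | rfl | hb
      · exact h.fst_mem b (by simp [hb])
      · exact h.fst_mem (A, W) (by simp)
      · exact h.fst_mem b (by simp [hb])
    · refine List.Sublist.trans ?_ h.sublist
      simp
    · have := h.last
      rcases List.eq_nil_or_concat L₂ with rfl | ⟨L₂, c, rfl⟩
      · simpa using this
      · simpa [List.getLast?_append, List.getLast?_cons] using this

theorem fst_eq (h : IsReachable w n i L) (hs : IsSquareFree (flat L))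
    {b : List Letter × List Letter} (hb : b ∈ L) : b.1 = P ∨ b.1 = Q := by
  obtain ⟨L₁, L₂, rfl⟩ := List.append_of_mem hb
  refine eq_P_or_Q (h.fst_mem b hb) (IsSquareFree.of_factor (U := flat L₁) (V := b.2 ++ flat L₂) ?_)
  simpa using hs

/-- Adjacent blocks of a square-free reachable word start with `P` and `Q` in this order. -/
theorem fst_of_adjacent (hw : Admissible w n) {L₁ L₂ : List (List Letter × List Letter)}
    {b c : List Letter × List Letter} (h : IsReachable w n i (L₁ ++ b :: c :: L₂))
    (hs : IsSquareFree (flat (L₁ ++ b :: c :: L₂))) : b.1 = P ∧ c.1 = Q := by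
  have hpre : b.2 <+: c.2 := by
    have hp := (pairwise_prefixes w n i).sublist h.sublist
    rw [List.map_append, List.pairwise_append] at hp
    obtain ⟨j, k, h1, h2, h3, e, e'⟩ := (List.pairwise_cons.1 hp.2.1).1 c.2 (by simp)
    rw [e, e']
    exact pref_prefix w (hw.2.2.2.1 h1 (show 1 ≤ k by omega) h2).le
  -- If `A = τ A'` and `W' = W π`, then `A W A' W'` is `τ (A' W)(A' W) π`.
  have hsuf : ¬ c.1 <:+ b.1 := by
    rintro ⟨τ, hτ⟩
    obtain ⟨π, hπ⟩ := hpre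
    have hne : c.1 ≠ [] := by
      rcases h.fst_eq hs (b := c) (by simp) with e | e <;> rw [e] <;> simp [P, Q]
    exact hs ⟨flat L₁ ++ τ, c.1 ++ b.2, π ++ flat L₂, by simp [hne], by simp [← hτ, ← hπ]⟩
  rcases h.fst_eq hs (b := b) (by simp) with e | e <;>
    rcases h.fst_eq hs (b := c) (by simp) with e' | e'
  · exact absurd (by rw [e, e']) hsuf
  · exact ⟨e, e'⟩
  -- `Q = xaba · P`, so `P` is a suffix of `Q`.
  · exact absurd (by rw [e, e']; exact ⟨[.x, .a, .b, .a], rfl⟩) hsuf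
  · exact absurd (by rw [e, e']) hsuf

/-- With three blocks, the middle one would have to start with `Q` as a right neighbour and with `P`
as a left neighbour. -/
theorem flat_eq_of_squareFree (hw : Admissible w n) (h : IsReachable w n i L)
    (hs : IsSquareFree (flat L)) :
    (flat L = P ++ pref w (n i) ∨ flat L = Q ++ pref w (n i)) ∨
      ∃ j, 1 ≤ j ∧ j < i ∧ flat L = P ++ pref w (n j) ++ Q ++ pref w (n i) := by
  match L, h, hs with
  | [], h, _ => simpa using h.last
  | [(A, W)], h, hs =>
    left
    have hl : W = pref w (n i) := by simpa using h.last
    rcases h.fst_eq hs (b := (A, W)) (by simp) with rfl | rfl <;> simp [hl]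
  | [(A, W), (A', W')], h, hs =>
    right
    obtain ⟨rfl, rfl⟩ : A = P ∧ A' = Q := fst_of_adjacent hw (L₁ := []) (L₂ := []) h hs
    have hp := (pairwise_prefixes w n i).sublist h.sublist
    obtain ⟨j, k, h1, h2, h3, rfl, -⟩ := (List.pairwise_cons.1 hp).1 W' (by simp)
    have hl : W' = pref w (n i) := by simpa using h.last
    exact ⟨j, h1, by omega, by simp [hl]⟩
  | (A, W) :: (A', W') :: (A'', W'') :: L, h, hs =>
    have h1 : A = P ∧ A' = Q := fst_of_adjacent hw (L₁ := []) h hs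
    have h2 : A' = P ∧ A'' = Q := fst_of_adjacent hw (L₁ := [(A, W)]) h hs
    exact absurd (h1.2.symm.trans h2.1) (by decide)

end IsReachable

/-! ### Determining and counting the reducts -/

section reducts

variable {w : ℕ → Letter} {n : ℕ → ℕ}

theorem isReachable_start (w : ℕ → Letter) (n : ℕ → ℕ) {i : ℕ} (hi : 1 ≤ i) :
    IsReachable w n i ((prefixes w n i).map fun W => (F, W)) := by
  obtain ⟨i, rfl⟩ : ∃ k, i = k + 1 := ⟨i - 1, by omega⟩
  refine ⟨?_, by simp [Function.comp_def], by simp [Function.comp_def, prefixes_succ]⟩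
  intro b hb
  obtain ⟨W, -, rfl⟩ := List.mem_map.1 hb
  simp [fReach]

theorem exists_isReachable (hw : Admissible w n) {i : ℕ} (hi : 1 ≤ i) {R : List Letter}
    (h : Relation.ReflTransGen SquareReduction (S w n i) R) :
    ∃ L, IsReachable w n i L ∧ R = flat L := by
  induction h with
  | refl => exact ⟨_, isReachable_start w n hi, S_eq_flat w n i⟩
  | tail _ h ih =>
    obtain ⟨L, hL, rfl⟩ := ih
    exact hL.reduction hw h

theorem isSquareFree_single (hw : Admissible w n) {i : ℕ} (hi : 1 ≤ i) {A : List Letter}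
    (hA : A = P ∨ A = Q) : IsSquareFree (A ++ pref w (n i)) := by
  have hmem : A ∈ fReach := by rcases hA with rfl | rfl <;> simp [fReach]
  refine isSquareFree_of_no_reduction fun T hT => ?_
  have hL : ∀ b ∈ [(A, pref w (n i))], IsBlock b := by
    simpa using isBlock_pref hw hi hmem
  rcases flat_square_cases (T := T) hL (by simpa using hT) with ⟨L₁, B, B', W, L₂, e, hB, -⟩ |
    ⟨L₁, L₂, L₃, e, h1, h2, -⟩ | ⟨L₁, B, B', W, W', L₂, e, -⟩
  · have hm : (B, W) ∈ [(A, pref w (n i))] := by rw [e]; simp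
    obtain ⟨rfl, -⟩ := Prod.mk.inj (List.mem_singleton.1 hm)
    exact (isSquareFree_P_Q hA).no_reduction hB
  · have := congrArg List.length e
    have := List.length_pos_iff.2 h1
    have := List.length_pos_iff.2 h2
    simp at *
    omega
  · have := congrArg List.length e
    simp at this
    omega

theorem isSquareFree_pair (hw : Admissible w n) {i j : ℕ} (hi : 1 ≤ i) (hj : 1 ≤ j) :
    IsSquareFree (P ++ pref w (n j) ++ Q ++ pref w (n i)) := by
  refine isSquareFree_of_no_reduction fun T hT => ?_
  have hL : ∀ b ∈ [(P, pref w (n j)), (Q, pref w (n i))], IsBlock b := by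
    simpa using ⟨isBlock_pref hw hj (by simp [fReach]), isBlock_pref hw hi (by simp [fReach])⟩
  rcases flat_square_cases (T := T) hL (by simpa using hT) with ⟨L₁, B, B', W, L₂, e, hB, -⟩ |
    ⟨L₁, L₂, L₃, e, h1, h2, h3, -⟩ | ⟨L₁, B, B', W, W', L₂, e, h, -⟩
  · have hm : (B, W) ∈ [(P, pref w (n j)), (Q, pref w (n i))] := by rw [e]; simp
    simp only [List.mem_cons, Prod.mk.injEq, List.not_mem_nil, or_false] at hm
    exact (isSquareFree_P_Q (hm.imp And.left And.left)).no_reduction hB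
  · have := congrArg List.length e
    have := List.length_pos_iff.2 h1
    have := List.length_pos_iff.2 h2
    have := List.length_pos_iff.2 h3
    simp only [List.length_append, List.length_cons, List.length_nil] at *
    omega
  · rcases L₁ with _ | ⟨c, L₁⟩
    · obtain ⟨e1, e2⟩ := List.cons.inj e
      obtain ⟨e2, -⟩ := List.cons.inj e2
      obtain ⟨rfl, -⟩ := Prod.mk.inj e1
      obtain ⟨rfl, -⟩ := Prod.mk.inj e2
      -- A merge would need `Q` to be a suffix of the shorter word `P`.
      exact absurd h.length_le (by decide)
    · have := congrArg List.length e
      simp at this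
      omega

/-- Two adjacent blocks starting with the same word reduce to the second one. -/
theorem merge_reduction (hw : Admissible w n) {j k : ℕ} (hj : 1 ≤ j) (hjk : j < k)
    (U : List Letter) {A : List Letter} (hA : A ≠ []) :
    SquareReduction (U ++ (A ++ pref w (n j)) ++ (A ++ pref w (n k)))
      (U ++ (A ++ pref w (n k))) := by
  obtain ⟨π, hπ⟩ := pref_prefix w (hw.2.2.2.1 hj (show 1 ≤ k by omega) hjk).le
  exact ⟨U, A ++ pref w (n j), π, by simp [hA], by simp [← hπ], by simp [← hπ]⟩

/-- Inductively, `A W_i F W_{i+1}` becomes `A W_i A W_{i+1}`, whose two blocks merge into `A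
W_{i+1}`. -/
theorem reaches_single (hw : Admissible w n) {A : List Letter} (hA : A ≠ [])
    (hF : Relation.ReflTransGen SquareReduction F A) {i : ℕ} (hi : 1 ≤ i) :
    Relation.ReflTransGen SquareReduction (S w n i) (A ++ pref w (n i)) := by
  induction i, hi using Nat.le_induction with
  | base => simpa [S] using reflTransGen_context [] (pref w (n 1)) hF
  | succ i hi ih =>
    have h1 := reflTransGen_context [] (F ++ pref w (n (i + 1))) ih
    have h2 := reflTransGen_context (A ++ pref w (n i)) (pref w (n (i + 1))) hF
    have h3 := merge_reduction hw hi (Nat.lt_succ_self i) [] hA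
    refine Relation.ReflTransGen.trans ?_ (.trans h2 (.single (by simpa using h3)))
    simpa [S] using h1

/-- The first `j` blocks collapse to `P W_j`; every later `F` is turned into `Q`, and the `Q` blocks
merge among themselves. -/
theorem reaches_pair (hw : Admissible w n) {i j : ℕ} (hj : 1 ≤ j) (hji : j < i) :
    Relation.ReflTransGen SquareReduction (S w n i)
      (P ++ pref w (n j) ++ Q ++ pref w (n i)) := by
  induction i, (show j + 1 ≤ i from hji) using Nat.le_induction with
  | base =>
    have h1 := reflTransGen_context [] (F ++ pref w (n (j + 1)))
      (reaches_single hw (by simp [P]) F_to_P hj)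
    have h2 := reflTransGen_context (P ++ pref w (n j)) (pref w (n (j + 1))) F_to_Q
    refine Relation.ReflTransGen.trans ?_ h2
    simpa [S] using h1
  | succ i hi ih =>
    have h1 := reflTransGen_context [] (F ++ pref w (n (i + 1))) (ih (by omega))
    have h2 := reflTransGen_context (P ++ pref w (n j) ++ Q ++ pref w (n i))
      (pref w (n (i + 1))) F_to_Q
    have h3 := merge_reduction hw (show 1 ≤ i by omega) (Nat.lt_succ_self i)
      (P ++ pref w (n j)) (A := Q) (by simp [Q])
    refine Relation.ReflTransGen.trans ?_ (.trans h2 (.single (by simpa using h3)))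
    simpa [S] using h1

theorem reducts_S (hw : Admissible w n) {i : ℕ} (hi : 1 ≤ i) :
    reducts (S w n i) = {P ++ pref w (n i), Q ++ pref w (n i)} ∪
      {R | ∃ j : ℕ, 1 ≤ j ∧ j < i ∧ R = P ++ pref w (n j) ++ Q ++ pref w (n i)} := by
  ext R
  constructor
  · rintro ⟨h, hs⟩
    obtain ⟨L, hL, rfl⟩ := exists_isReachable hw hi h
    exact hL.flat_eq_of_squareFree hw hs
  · rintro ((rfl | rfl) | ⟨j, hj, hji, rfl⟩)
    · exact ⟨reaches_single hw (by simp [P]) F_to_P hi, isSquareFree_single hw hi (.inl rfl)⟩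
    · exact ⟨reaches_single hw (by simp [Q]) F_to_Q hi, isSquareFree_single hw hi (.inr rfl)⟩
    · exact ⟨reaches_pair hw hj hji, isSquareFree_pair hw hi hj⟩

theorem ncard_reducts_S (hw : Admissible w n) {i : ℕ} (hi : 1 ≤ i) :
    (reducts (S w n i)).ncard = i + 1 := by
  have himg : {R | ∃ j : ℕ, 1 ≤ j ∧ j < i ∧ R = P ++ pref w (n j) ++ Q ++ pref w (n i)} =
      (fun j => P ++ pref w (n j) ++ Q ++ pref w (n i)) '' (Finset.Ico 1 i : Finset ℕ) := by
    ext R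
    simp [eq_comm, and_assoc]
  have hinj : Set.InjOn (fun j => P ++ pref w (n j) ++ Q ++ pref w (n i))
      (Finset.Ico 1 i : Finset ℕ) := by
    intro j hj k hk e
    rw [Finset.coe_Ico] at hj hk
    have := congrArg List.length e
    simp only [List.length_append, pref_length] at this
    exact hw.2.2.2.1.injOn hj.1 hk.1 (by omega)
  have hne : P ++ pref w (n i) ≠ Q ++ pref w (n i) := by
    intro e
    have := congrArg List.length e
    simp [P, Q] at this
  -- Lengths separate the two families: `4 + n i` and `8 + n i` against `12 + n j + n i`.
  have hdisj : Disjoint ({P ++ pref w (n i), Q ++ pref w (n i)} : Set (List Letter))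
      {R | ∃ j : ℕ, 1 ≤ j ∧ j < i ∧ R = P ++ pref w (n j) ++ Q ++ pref w (n i)} := by
    rw [Set.disjoint_left]
    rintro R (rfl | rfl) ⟨j, -, -, e⟩ <;>
    · have := congrArg List.length e
      simp only [List.length_append, pref_length, P, Q, List.length_cons, List.length_nil] at this
      omega
  rw [reducts_S hw hi, Set.ncard_union_eq hdisj (Set.toFinite _)
    (by rw [himg]; exact (Finset.finite_toSet _).image _), Set.ncard_pair hne, himg,
    hinj.ncard_image, Set.ncard_coe_finset, Nat.card_Ico]
  omega

theorem reducts_nil {α : Type*} : reducts ([] : List α) = {[]} := by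
  have hsf : IsSquareFree ([] : List α) := by
    rintro ⟨U, X, V, hX, e⟩
    simp [hX] at e
  ext R
  constructor
  · rintro ⟨h, -⟩
    rcases h.cases_head with rfl | ⟨T, h, -⟩
    · rfl
    · exact absurd h hsf.no_reduction
  · rintro rfl
    exact ⟨.refl, hsf⟩

end reducts

end SquareReduct

theorem theorem2p6 :
    (∀ k : ℕ, 1 ≤ k →
      ∃ W : List SquareReduct.Letter, (SquareReduct.reducts W).ncard = k) ∧
    (∃ (w : ℕ → SquareReduct.Letter) (n : ℕ → ℕ), SquareReduct.Admissible w n) ∧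
    (∀ (w : ℕ → SquareReduct.Letter) (n : ℕ → ℕ), SquareReduct.Admissible w n →
      ∀ i : ℕ, 1 ≤ i →
        SquareReduct.reducts (SquareReduct.S w n i) =
          {SquareReduct.P ++ SquareReduct.pref w (n i),
            SquareReduct.Q ++ SquareReduct.pref w (n i)} ∪
          {R | ∃ j : ℕ, 1 ≤ j ∧ j < i ∧
            R = SquareReduct.P ++ SquareReduct.pref w (n j) ++
              SquareReduct.Q ++ SquareReduct.pref w (n i)} ∧
        (SquareReduct.reducts (SquareReduct.S w n i)).ncard = i + 1) := by
  refine ⟨fun k hk => ?_, SquareReduct.exists_admissible, fun w n hw i hi =>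
    ⟨SquareReduct.reducts_S hw hi, SquareReduct.ncard_reducts_S hw hi⟩⟩
  obtain ⟨w, n, hw⟩ := SquareReduct.exists_admissible
  rcases hk.eq_or_lt with rfl | hk
  -- The words `S w n i` with `i ≥ 1` have at least two reducts, so `k = 1` needs its own witness.
  · exact ⟨[], by rw [SquareReduct.reducts_nil, Set.ncard_singleton]⟩
  · exact ⟨SquareReduct.S w n (k - 1), by
      rw [SquareReduct.ncard_reducts_S hw (by omega)]; omega⟩
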